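/- Let $T\in[0,\infty)$, let $I\subset[0,T]$ with $\{0,T\}\subset I$, and let $d\in\mathbb{N}$. A \emph{financial experiment} consists of a measurable space $(\Omega,\mathcal F)$, a filtration $(\mathcal F_t)_{t\in I}$ with $\mathcal F=\sigma(\mathcal F_t:t\in I)$, adapted positive (discounted price) processes $(X^i_t)_{t\in I}$, $1\le i\le d$, and probability measures $Q_1,\dots,Q_d,Q$ on $(\Omega,\mathcal F)$ such that $Q_i\ll Q$ and $$\frac{dQ_{i|\mathcal F_t}}{dQ_{|\mathcal F_t}}=\frac{X^i_t}{X^i_0}\qquad (t\in I,\ 1\le i\le d).$$ Let $Y_T:=\big((X^i_s/X^i_0)_{1\le i\le d}\big)_{s\in I}$, a random element of the path space $([0,\infty)^d)^I$ with the product $\sigma$-field. On this path space let $\pi_t=(\pi^i_t)_{i\le d}$ denote the coordinate projections and $\mathcal G_t:=\sigma(\pi_s:s\in I\cap[0,t])$. Let $E_n=(\Omega_n,\mathcal F_n,\{Q_{1,n},\dots,Q_{d,n},Q_n\})$, $(\mathcal F_{t,n})_{t\in I}$, $n\in\mathbb N$, be a sequence of financial experiments (with the same $I$ and $d$) and let $Y_{T,n}$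 be the corresponding path-valued maps. Write $Q_{d+1,n}:=Q_n$. Assume that for each $i=1,\dots,d$ the sequences $(Q_{i,n})_n$ and $(Q_n)_n$ are mutually contiguous, i.e. for all $A_n\in\mathcal F_n$: $Q_n(A_n)\to0$ if and only if $Q_{i,n}(A_n)\to0$. Let $\nu_1,\dots,\nu_d,\nu=:\nu_{d+1}$ be probability measures on $([0,\infty)^d)^I$ which form a weak cluster point of $(E_n)$, that is, $$\frac{d\nu_{i|\mathcal G_t}}{d\nu_{|\mathcal G_t}}=\pi^i_t\qquad (t\in I,\ 1\le i\le d),$$ and there is a subnet $(n_\tau)_{\tau\in\mathcal I}$ of $(\mathbb N,\le)$ along which, for every $i=1,\dots,d+1$, all finite dimensional marginal distributions of $\mathcal L(Y_{T,n_\tau}\,|\,Q_{i,n_\tau})$ converge weakly to the corresponding marginal distributions of $\nu_i$. Then for every sequence of tests (measurable functions) $\phi_n:\Omega_n\to[0,1]$ there exist a test $\phi:([0,\infty)^d)^I\to[0,1]$ and a subsequence $(n_k)_{k\in\mathbb N}$ of $\mathbb N$ such that $$E_{Q_{i,n_k}}(\phi_{n_k})\longrightarrow E_{\nu_i}(\phi)\quad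 (k\to\infty)\qquad\text{for all } i=1,\dots,d+1.$$ -/

import Mathlib

open Filter Topology MeasureTheory
open scoped NNReal ENNReal

/-- `I` is a trading period with horizon `T`: `{0, T} ⊆ I ⊆ [0, T]`. -/
structure IsTradingPeriod (I : Set ℝ) (T : ℝ) : Prop where
  zero_mem : (0 : ℝ) ∈ I
  end_mem : T ∈ I
  subset : I ⊆ Set.Icc 0 T

/-- `dμ|_𝓖 / dρ|_𝓖 = f`: the function `f` is `𝓖`-measurable and is the density of the restriction
of `μ` to the sub-σ-field `𝓖` with respect to the restriction of `ρ` to `𝓖`. -/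
def IsRestrictedDensity {Ω : Type*} (𝓖 : MeasurableSpace Ω) [MeasurableSpace Ω]
    (μ ρ : Measure Ω) (f : Ω → ℝ≥0) : Prop :=
  Measurable[𝓖] f ∧ ∀ A : Set Ω, MeasurableSet[𝓖] A → μ A = ∫⁻ ω in A, (f ω : ℝ≥0∞) ∂ρ

/-- A financial experiment `(Ω, 𝓕, {Q₁, …, Q_d, Q})` with filtration `(𝓕 t)`, `t ∈ I`, and positive
adapted discounted price processes `X¹, …, X^d`. The measures are indexed by `Fin (d + 1)`:
`Q i.castSucc` is the measure belonging to the `i`-th price process and `Q (Fin.last d)` is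
the martingale measure. The filtration is arbitrary up to `𝓕 = σ(𝓕 t : t ∈ I)`; no condition is
put on the initial σ-field. -/
structure FinancialExperiment {I : Set ℝ} {T : ℝ} (hI : IsTradingPeriod I T) (d : ℕ)
    (Ω : Type*) [mΩ : MeasurableSpace Ω] where
  /-- the filtration -/
  𝓕 : Filtration I mΩ
  iSup_filtration : ⨆ t, 𝓕 t = mΩ
  /-- the discounted price processes -/
  X : I → Fin d → Ω → ℝ≥0
  X_pos : ∀ t i ω, 0 < X t i ω
  adapted : ∀ t i, Measurable[𝓕 t] (X t i)
  /-- the probability measures `Q₁, …, Q_d, Q_{d+1} = Q` -/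
  Q : Fin (d + 1) → ProbabilityMeasure Ω
  absolutelyContinuous : ∀ i : Fin d,
    (Q i.castSucc : Measure Ω) ≪ (Q (Fin.last d) : Measure Ω)
  likelihood : ∀ (t : I) (i : Fin d),
    IsRestrictedDensity (𝓕 t) (Q i.castSucc : Measure Ω) (Q (Fin.last d) : Measure Ω)
      (fun ω => X t i ω / X ⟨0, hI.zero_mem⟩ i ω)

/-- The path space `([0,∞)^d)^I`; it carries the product σ-field. -/
abbrev PathSpace (I : Set ℝ) (d : ℕ) : Type := I → Fin d → ℝ≥0

namespace FinancialExperiment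

variable {I : Set ℝ} {T : ℝ} {hI : IsTradingPeriod I T} {d : ℕ} {Ω : Type*} [mΩ : MeasurableSpace Ω]

/-- The path-valued statistic `Y_T = ((X_s^i / X_0^i)_{i ≤ d})_{s ∈ I}`. -/
noncomputable def Y (E : FinancialExperiment hI d Ω) (ω : Ω) : PathSpace I d :=
  fun s i => E.X s i ω / E.X ⟨0, hI.zero_mem⟩ i ω

theorem measurable_Y (E : FinancialExperiment hI d Ω) : Measurable E.Y := by
  refine measurable_pi_iff.2 fun s => measurable_pi_iff.2 fun i => ?_
  exact ((E.adapted s i).mono (E.𝓕.le s) le_rfl).div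
    ((E.adapted ⟨0, hI.zero_mem⟩ i).mono (E.𝓕.le _) le_rfl)

/-- The law `𝓛(Y_T | Q_i)` on the path space. -/
noncomputable def pathLaw (E : FinancialExperiment hI d Ω) (i : Fin (d + 1)) :
    ProbabilityMeasure (PathSpace I d) :=
  (E.Q i).map E.measurable_Y.aemeasurable

end FinancialExperiment

/-- The finite dimensional marginal distribution on `([0,∞)^d)^J`, for a finite `J ⊆ I`. -/
noncomputable def finiteMarginal {I : Set ℝ} {d : ℕ} (μ : ProbabilityMeasure (PathSpace I d))
    (J : Finset I) : ProbabilityMeasure (J → Fin d → ℝ≥0) :=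
  μ.map (Finset.measurable_restrict (X := fun _ : I => Fin d → ℝ≥0) J).aemeasurable

/-- The probability measures `ν₁, …, ν_d, ν = ν_{d+1}` on the path space form a standard financial
experiment with the canonical price process: `dν_i|𝓖_t / dν|𝓖_t = π_t^i` for all `t ∈ I`, `i ≤ d`,
where `𝓖_t = σ(π_s : s ∈ I ∩ [0, t])`. -/
def IsStandardFinancialExperiment {I : Set ℝ} {d : ℕ}
    (ν : Fin (d + 1) → ProbabilityMeasure (PathSpace I d)) : Prop :=
  ∀ (t : I) (i : Fin d),
    IsRestrictedDensity (cylinderEvents (X := fun _ : I => Fin d → ℝ≥0) (Set.Iic t))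
      (ν i.castSucc : Measure (PathSpace I d)) (ν (Fin.last d) : Measure (PathSpace I d))
      (fun x => x t i)

/-- `P n ◁ Q n`: the sequence `P` is contiguous with respect to the sequence `Q`. -/
def Contiguous {Ω : ℕ → Type*} [∀ n, MeasurableSpace (Ω n)]
    (P Q : ∀ n, ProbabilityMeasure (Ω n)) : Prop :=
  ∀ A : ∀ n, Set (Ω n), (∀ n, MeasurableSet (A n)) →
    Tendsto (fun n => (Q n : Measure (Ω n)) (A n)) atTop (𝓝 0) →
    Tendsto (fun n => (P n : Measure (Ω n)) (A n)) atTop (𝓝 0)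

/-- The standard financial experiment `ν` is a weak cluster point of the sequence `E`, along the
subnet `N : ι → ℕ` of `(ℕ, ≤)` with directed index set `ι`: all finite dimensional marginals of
`𝓛(Y_{T,τ} | Q_{i,τ})` converge weakly along the subnet to those of `ν_i`, for all `i ≤ d + 1`. -/
structure IsWeakClusterPointAlong {I : Set ℝ} {T : ℝ} {hI : IsTradingPeriod I T} {d : ℕ}
    {Ω : ℕ → Type*} [∀ n, MeasurableSpace (Ω n)] (E : ∀ n, FinancialExperiment hI d (Ω n))
    {ι : Type*} [Preorder ι] (N : ι → ℕ)
    (ν : Fin (d + 1) → ProbabilityMeasure (PathSpace I d)) : Prop where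
  standard : IsStandardFinancialExperiment ν
  subnet : Tendsto N atTop atTop
  tendsto_marginal : ∀ (i : Fin (d + 1)) (J : Finset I),
    Tendsto (fun τ => finiteMarginal ((E (N τ)).pathLaw i) J) atTop
      (𝓝 (finiteMarginal (ν i) J))

/-- A (randomized) test: a measurable function with values in `[0, 1]`. -/
def IsTest {Ω : Type*} [MeasurableSpace Ω] (φ : Ω → ℝ) : Prop :=
  Measurable φ ∧ ∀ ω, φ ω ∈ Set.Icc (0 : ℝ) 1

/-! Since `T ∈ I` and the σ-field at `T` is everything, `dQ_i/dQ` is a coordinate of the terminal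
relative price vector `Z n`, or `1` for `Q` itself. So each power is the `Q`-integral of `φ n * D i
(Z n)` with `D i` continuous on the Polish space `Fin d → ℝ≥0`, and only the time-`T` marginal under
`Q` matters. There the subnet can be replaced by a subsequence, by first countability.

Adjoin the test as an extra coordinate in `[0, 1]`. The laws of `(Z n, φ n)` are tight because their
first marginals converge, so a further subsequence has a weak limit `m`. The limiting test is the
conditional mean of the `[0, 1]`-coordinate under `m` given the price vector, composed with the
projection at `T`.

The densities are unbounded, so weak convergence alone does not give convergence of the powers. It
does here because every `D i` has mass one before and in the limit, as each `ν i` is a probability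
measure with density `D i`: no mass escapes. -/

/-- A family of laws on `S × K` with `K` compact has a convergent subsequence as soon as
its first marginals converge. -/
theorem exists_subseq_tendsto_of_tendsto_map_fst {S K : Type*}
    [TopologicalSpace S] [PolishSpace S] [MeasurableSpace S] [BorelSpace S]
    [TopologicalSpace K] [PolishSpace K] [CompactSpace K] [MeasurableSpace K] [BorelSpace K]
    (P : ℕ → ProbabilityMeasure (S × K)) {μ : ProbabilityMeasure S}
    (hP : Tendsto (fun n => (P n).map (measurable_fst (α := S) (β := K)).aemeasurable)
      atTop (𝓝 μ)) :
    ∃ m : ProbabilityMeasure (S × K), ∃ k : ℕ → ℕ, StrictMono k ∧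
      Tendsto (P ∘ k) atTop (𝓝 m) ∧
      m.map (measurable_fst (α := S) (β := K)).aemeasurable = μ := by
  let := TopologicalSpace.upgradeIsCompletelyMetrizable S
  let := TopologicalSpace.upgradeIsCompletelyMetrizable K
  -- A convergent sequence together with its limit is compact, and on a Polish space relatively
  -- compact families are tight.
  have htight := isTightMeasureSet_of_isCompact_closure
    (hP.isCompact_insert_range.closure)
  have htight' : IsTightMeasureSet
      {((ρ : ProbabilityMeasure (S × K)) : Measure (S × K)) | ρ ∈ Set.range P} := by
    rw [isTightMeasureSet_iff_exists_isCompact_measure_compl_le] at htight ⊢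
    intro ε hε
    obtain ⟨C, hC, hle⟩ := htight ε hε
    refine ⟨C ×ˢ Set.univ, hC.prod isCompact_univ, ?_⟩
    rintro _ ⟨_, ⟨n, rfl⟩, rfl⟩
    have h := hle _ ⟨_, Set.mem_insert_of_mem _ ⟨n, rfl⟩, rfl⟩
    rw [ProbabilityMeasure.toMeasure_map,
      Measure.map_apply measurable_fst hC.measurableSet.compl] at h
    refine le_trans (measure_mono ?_) h
    intro x hx
    simpa using hx
  obtain ⟨m, -, k, hk, hm⟩ := (isCompact_closure_of_isTightMeasureSet htight').tendsto_subseq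
    (fun n => subset_closure (Set.mem_range_self n))
  refine ⟨m, k, hk, hm, tendsto_nhds_unique ?_ (hP.comp hk.tendsto_atTop)⟩
  exact ProbabilityMeasure.tendsto_map_of_tendsto_of_continuous _ _ hm continuous_fst

/-- If both summands of a constant sum are lower semicontinuous along a sequence and the limits
have the same sum, then the first summand converges. -/
theorem ENNReal.tendsto_of_add_eq_of_le_liminf {a b : ℕ → ℝ≥0∞} {a' b' c : ℝ≥0∞} (hc : c ≠ ∞)
    (hab : ∀ n, a n + b n = c) (hab' : a' + b' = c)
    (ha : a' ≤ liminf a atTop) (hb : b' ≤ liminf b atTop) :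
    Tendsto a atTop (𝓝 a') := by
  refine tendsto_of_le_liminf_of_limsup_le ha ?_
  have hb_top : ∀ n, b n ≠ ∞ := fun n h => hc (by simp [← hab n, h])
  have hb'_top : b' ≠ ∞ := fun h => hc (by simp [← hab', h])
  have h1 : a = fun n => c - b n := funext fun n => ENNReal.eq_sub_of_add_eq (hb_top n) (hab n)
  rw [ENNReal.eq_sub_of_add_eq hb'_top hab', h1, ENNReal.limsup_const_sub _ _ hc]
  exact tsub_le_tsub_left hb c

/-- Integrals of a continuous `[0, 1]`-valued function against measures with continuous densities
of constant mass are continuous under weak convergence. -/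
theorem tendsto_lintegral_mul_of_tendsto {X : Type*} [TopologicalSpace X] [MeasurableSpace X]
    [OpensMeasurableSpace X] [HasOuterApproxClosed X]
    {P : ℕ → ProbabilityMeasure X} {m : ProbabilityMeasure X} (hP : Tendsto P atTop (𝓝 m))
    {u : X → ℝ} (hu : Continuous u) (hu01 : ∀ x, u x ∈ Set.Icc (0 : ℝ) 1)
    {D : X → ℝ≥0} (hD : Continuous D) {c : ℝ≥0∞} (hc : c ≠ ∞)
    (hPc : ∀ n, ∫⁻ x, D x ∂(P n : Measure X) = c) (hmc : ∫⁻ x, D x ∂(m : Measure X) = c) :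
    Tendsto (fun n => ∫⁻ x, ENNReal.ofReal (u x) * D x ∂(P n : Measure X)) atTop
      (𝓝 (∫⁻ x, ENNReal.ofReal (u x) * D x ∂(m : Measure X))) := by
  -- Portmanteau for open sets gives a Fatou inequality for nonnegative continuous integrands,
  -- bounded or not. Applied to `u` and `1 - u`, whose integrals add up to `c`, it forces
  -- convergence.
  have hlsc : ∀ v : X → ℝ, Continuous v → (∀ x, 0 ≤ v x) →
      ∫⁻ x, ENNReal.ofReal (v x) * D x ∂(m : Measure X) ≤
        liminf (fun n => ∫⁻ x, ENNReal.ofReal (v x) * D x ∂(P n : Measure X)) atTop := by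
    intro v hv hv0
    have h := lintegral_le_liminf_lintegral_of_forall_isOpen_measure_le_liminf_measure
      (μ := (m : Measure X)) (μs := fun n => (P n : Measure X))
      (f := fun x => v x * (D x : ℝ)) (by fun_prop)
      (fun x => mul_nonneg (hv0 x) (D x).coe_nonneg)
      (fun G hG => ProbabilityMeasure.le_liminf_measure_open_of_tendsto hP hG)
    simpa only [fun x => ENNReal.ofReal_mul (q := (D x : ℝ)) (hv0 x),
      ENNReal.ofReal_coe_nnreal] using h
  have hsum : ∀ ρ : Measure X, ∫⁻ x, ENNReal.ofReal (u x) * D x ∂ρ +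
      ∫⁻ x, ENNReal.ofReal (1 - u x) * D x ∂ρ = ∫⁻ x, D x ∂ρ := by
    intro ρ
    rw [← lintegral_add_left (by fun_prop)]
    refine lintegral_congr fun x => ?_
    rw [← add_mul, ← ENNReal.ofReal_add (hu01 x).1 (sub_nonneg.2 (hu01 x).2)]
    simp
  exact ENNReal.tendsto_of_add_eq_of_le_liminf hc (fun n => (hsum _).trans (hPc n))
    ((hsum _).trans hmc) (hlsc u hu fun x => (hu01 x).1)
    (hlsc (fun x => 1 - u x) (by fun_prop) fun x => sub_nonneg.2 (hu01 x).2)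

/-- Tests on experiments with densities `D i ∘ Z n`, `D i` continuous, have a limiting test along a
subsequence when the laws of `Z n` converge weakly without loss of mass of the densities. -/
theorem exists_test_tendsto_lintegral {S : Type*} [TopologicalSpace S] [PolishSpace S]
    [MeasurableSpace S] [BorelSpace S] {α : Type*} {D : α → S → ℝ≥0} (hD : ∀ i, Continuous (D i))
    {Ω : ℕ → Type*} [∀ n, MeasurableSpace (Ω n)] (Q : ∀ n, ProbabilityMeasure (Ω n))
    {Z : ∀ n, Ω n → S} (hZ : ∀ n, Measurable (Z n)) {μ : ProbabilityMeasure S}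
    (hlaw : Tendsto (fun n => (Q n).map (hZ n).aemeasurable) atTop (𝓝 μ))
    (hQ : ∀ i n, ∫⁻ ω, D i (Z n ω) ∂(Q n : Measure (Ω n)) = 1)
    (hμ : ∀ i, ∫⁻ z, D i z ∂(μ : Measure S) = 1)
    {φ : ∀ n, Ω n → ℝ} (hφ : ∀ n, IsTest (φ n)) :
    ∃ h : S → ℝ, IsTest h ∧ ∃ k : ℕ → ℕ, StrictMono k ∧ ∀ i,
      Tendsto (fun j => ∫⁻ ω, ENNReal.ofReal (φ (k j) ω) * D i (Z (k j) ω)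
        ∂(Q (k j) : Measure (Ω (k j)))) atTop
        (𝓝 (∫⁻ z, ENNReal.ofReal (h z) * D i z ∂(μ : Measure S))) := by
  let W : ∀ n, Ω n → S × Set.Icc (0 : ℝ) 1 := fun n ω => (Z n ω, ⟨φ n ω, (hφ n).2 ω⟩)
  have hW : ∀ n, Measurable (W n) := fun n => (hZ n).prodMk ((hφ n).1.subtype_mk)
  have hmap : ∀ n, ((Q n).map (hW n).aemeasurable).map
      (measurable_fst (α := S) (β := Set.Icc (0 : ℝ) 1)).aemeasurable
      = (Q n).map (hZ n).aemeasurable := by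
    intro n
    apply Subtype.ext
    change Measure.map _ (Measure.map _ _) = Measure.map _ _
    rw [Measure.map_map measurable_fst (hW n)]
    rfl
  obtain ⟨m, k, hk, hm, hmμ⟩ := exists_subseq_tendsto_of_tendsto_map_fst
    (fun n => (Q n).map (hW n).aemeasurable) (μ := μ) (by simpa only [hmap] using hlaw)
  have hfst : (m : Measure (S × Set.Icc (0 : ℝ) 1)).fst = μ := by
    rw [← hmμ]; rfl
  -- Conditional mean of the test coordinate given `z`, under the limit law.
  let g : S → ℝ≥0∞ := fun z => ∫⁻ y : Set.Icc (0 : ℝ) 1, ENNReal.ofReal y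
    ∂((m : Measure (S × Set.Icc (0 : ℝ) 1)).condKernel z)
  have hg : Measurable g := Measurable.lintegral_kernel (by fun_prop)
  have hg1 : ∀ z, g z ≤ 1 := by
    intro z
    calc g z ≤ ∫⁻ _, 1 ∂((m : Measure (S × Set.Icc (0 : ℝ) 1)).condKernel z) :=
          lintegral_mono fun y => ENNReal.ofReal_le_one.2 y.2.2
      _ = 1 := by simp
  refine ⟨fun z => (g z).toReal, ⟨hg.ennreal_toReal, fun z => ⟨ENNReal.toReal_nonneg,
    ENNReal.toReal_le_of_le_ofReal zero_le_one (by simpa using hg1 z)⟩⟩, k, hk, fun i => ?_⟩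
  have hDm : Measurable (D i) := (hD i).measurable
  have hlim := tendsto_lintegral_mul_of_tendsto hm
    (u := fun x : S × Set.Icc (0 : ℝ) 1 => (x.2 : ℝ)) (by fun_prop) (fun x => x.2.2)
    (D := fun x => D i x.1) ((hD i).comp continuous_fst) ENNReal.one_ne_top
    (fun n => by
      change ∫⁻ x, _ ∂(Measure.map (W (k n)) _) = 1
      rw [lintegral_map (by fun_prop) (hW _)]
      exact hQ i (k n))
    (by rw [← hμ i, ← hfst, Measure.fst, lintegral_map (by fun_prop) measurable_fst])
  convert hlim using 2 with j
  · change _ = ∫⁻ x, _ ∂(Measure.map (W (k j)) _)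
    rw [lintegral_map (by fun_prop) (hW _)]
  -- `D i` depends on the first coordinate only, so it leaves the inner integral of the
  -- disintegration.
  · rw [← Measure.lintegral_condKernel (by fun_prop), hfst]
    refine lintegral_congr fun z => ?_
    dsimp only
    rw [lintegral_mul_const _ (by fun_prop),
      ENNReal.ofReal_toReal ((hg1 z).trans_lt ENNReal.one_lt_top).ne]

/-- If a map from a directed set to `ℕ` tends to infinity and `x` converges along it in a first
countable space, then `x` converges along a subsequence. -/
theorem exists_strictMono_tendsto_of_tendsto_comp {X ι : Type*} [TopologicalSpace X]
    [FirstCountableTopology X] {l : Filter ι} [l.NeBot] {N : ι → ℕ} (hN : Tendsto N l atTop)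
    {x : ℕ → X} {a : X} (h : Tendsto (x ∘ N) l (𝓝 a)) :
    ∃ k : ℕ → ℕ, StrictMono k ∧ Tendsto (x ∘ k) atTop (𝓝 a) :=
  -- A limit along the subnet is a cluster point of the full sequence.
  (MapClusterPt.of_comp hN h.mapClusterPt).tendsto_subseq

/-- The densities of `Q₁, …, Q_d, Q` with respect to `Q`, as functions of the terminal relative
prices. -/
def terminalDensity {d : ℕ} (i : Fin (d + 1)) (z : Fin d → ℝ≥0) : ℝ≥0 :=
  Fin.lastCases (motive := fun _ => ℝ≥0) 1 z i

@[simp]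
theorem terminalDensity_castSucc {d : ℕ} (i : Fin d) (z : Fin d → ℝ≥0) :
    terminalDensity i.castSucc z = z i := by
  simp [terminalDensity]

@[simp]
theorem terminalDensity_last {d : ℕ} (z : Fin d → ℝ≥0) : terminalDensity (Fin.last d) z = 1 := by
  simp [terminalDensity]

theorem continuous_terminalDensity {d : ℕ} (i : Fin (d + 1)) :
    Continuous (terminalDensity i) := by
  refine Fin.lastCases ?_ (fun i => ?_) i
  · simpa only [funext terminalDensity_last] using continuous_const
  · simpa only [funext (terminalDensity_castSucc i)] using continuous_apply i

/-- A density on the whole `σ`-field expresses the measure through `withDensity`. -/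
theorem IsRestrictedDensity.eq_withDensity {Ω : Type*} [mΩ : MeasurableSpace Ω]
    {μ ρ : Measure Ω} {f : Ω → ℝ≥0} (h : IsRestrictedDensity mΩ μ ρ f) :
    μ = ρ.withDensity fun ω => (f ω : ℝ≥0∞) :=
  Measure.ext fun A hA => by rw [withDensity_apply _ hA, h.2 A hA]

theorem eq_withDensity_terminalDensity {Ω : Type*} [mΩ : MeasurableSpace Ω] {d : ℕ}
    {Q : Fin (d + 1) → ProbabilityMeasure Ω} {Z : Ω → Fin d → ℝ≥0}
    (h : ∀ i : Fin d, IsRestrictedDensity mΩ (Q i.castSucc : Measure Ω)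
      (Q (Fin.last d) : Measure Ω) fun ω => Z ω i) (i : Fin (d + 1)) :
    (Q i : Measure Ω) =
      (Q (Fin.last d) : Measure Ω).withDensity fun ω => (terminalDensity i (Z ω) : ℝ≥0∞) := by
  refine Fin.lastCases ?_ (fun i => ?_) i
  · simp
  · simpa using (h i).eq_withDensity

/-- Supplies the constant mass that rules out loss of mass in the limit. -/
theorem lintegral_terminalDensity {Ω : Type*} [MeasurableSpace Ω] {d : ℕ}
    {Q : Fin (d + 1) → ProbabilityMeasure Ω} {Z : Ω → Fin d → ℝ≥0} {i : Fin (d + 1)}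
    (h : (Q i : Measure Ω) =
      (Q (Fin.last d) : Measure Ω).withDensity fun ω => (terminalDensity i (Z ω) : ℝ≥0∞)) :
    ∫⁻ ω, terminalDensity i (Z ω) ∂(Q (Fin.last d) : Measure Ω) = 1 := by
  rw [← setLIntegral_univ, ← withDensity_apply _ MeasurableSet.univ, ← h, measure_univ]

/-- Expresses all powers through the single base measure `Q (Fin.last d)`, whose terminal laws
converge. -/
theorem integral_eq_toReal_lintegral_terminalDensity {Ω : Type*} [MeasurableSpace Ω] {d : ℕ}
    {Q : Fin (d + 1) → ProbabilityMeasure Ω} {Z : Ω → Fin d → ℝ≥0} (hZ : Measurable Z)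
    {i : Fin (d + 1)} (h : (Q i : Measure Ω) =
      (Q (Fin.last d) : Measure Ω).withDensity fun ω => (terminalDensity i (Z ω) : ℝ≥0∞))
    {φ : Ω → ℝ} (hφ : IsTest φ) :
    ∫ ω, φ ω ∂(Q i : Measure Ω) = (∫⁻ ω, ENNReal.ofReal (φ ω) * terminalDensity i (Z ω)
      ∂(Q (Fin.last d) : Measure Ω)).toReal := by
  have hD : Measurable (terminalDensity i) := (continuous_terminalDensity i).measurable
  have hφm : Measurable φ := hφ.1
  rw [integral_eq_lintegral_of_nonneg_ae (Eventually.of_forall fun ω => (hφ.2 ω).1)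
    hφm.aestronglyMeasurable, h, lintegral_withDensity_eq_lintegral_mul _ (by fun_prop)
    (by fun_prop)]
  simp only [Pi.mul_apply, mul_comm]

/-- The terminal `σ`-field of the filtration of a financial experiment is the whole `σ`-field. -/
theorem FinancialExperiment.filtration_end {I : Set ℝ} {T : ℝ} {hI : IsTradingPeriod I T} {d : ℕ}
    {Ω : Type*} [mΩ : MeasurableSpace Ω] (E : FinancialExperiment hI d Ω) :
    E.𝓕 ⟨T, hI.end_mem⟩ = mΩ :=
  le_antisymm (E.𝓕.le _) <| E.iSup_filtration.symm.le.trans <|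
    iSup_le fun t => E.𝓕.mono (hI.subset t.2).2

theorem IsTradingPeriod.cylinderEvents_Iic_end {I : Set ℝ} {T : ℝ} (hI : IsTradingPeriod I T)
    (d : ℕ) : cylinderEvents (X := fun _ : I => Fin d → ℝ≥0) (Set.Iic ⟨T, hI.end_mem⟩) =
      MeasurableSpace.pi := by
  have : Set.Iic (⟨T, hI.end_mem⟩ : I) = Set.univ :=
    Set.eq_univ_of_forall fun t => (hI.subset t.2).2
  rw [this, cylinderEvents_univ]

theorem mainTheorem7 {I : Set ℝ} {T : ℝ} (hI : IsTradingPeriod I T) {d : ℕ}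
    {Ω : ℕ → Type*} [∀ n, MeasurableSpace (Ω n)]
    (E : ∀ n, FinancialExperiment hI d (Ω n))
    (hcont : ∀ i : Fin d,
      Contiguous (fun n => (E n).Q i.castSucc) (fun n => (E n).Q (Fin.last d)) ∧
      Contiguous (fun n => (E n).Q (Fin.last d)) (fun n => (E n).Q i.castSucc))
    {ι : Type*} [Preorder ι] [IsDirectedOrder ι] [Nonempty ι] (N : ι → ℕ)
    (ν : Fin (d + 1) → ProbabilityMeasure (PathSpace I d))
    (hν : IsWeakClusterPointAlong E N ν)
    (φ : ∀ n, Ω n → ℝ) (hφ : ∀ n, IsTest (φ n)) :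
    ∃ ψ : PathSpace I d → ℝ, IsTest ψ ∧
      ∃ k : ℕ → ℕ, StrictMono k ∧
        ∀ i : Fin (d + 1),
          Tendsto (fun j => ∫ ω, φ (k j) ω ∂((E (k j)).Q i : Measure (Ω (k j)))) atTop
            (𝓝 (∫ x, ψ x ∂(ν i : Measure (PathSpace I d)))) := by
  let e : I := ⟨T, hI.end_mem⟩
  let p : PathSpace I d → Fin d → ℝ≥0 := fun x => x e
  have hp : Measurable p := measurable_pi_apply e
  let Z : ∀ n, Ω n → Fin d → ℝ≥0 := fun n ω => (E n).Y ω e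
  have hZ : ∀ n, Measurable (Z n) := fun n => hp.comp (E n).measurable_Y
  have hE : ∀ n i, ((E n).Q i : Measure (Ω n)) = ((E n).Q (Fin.last d) : Measure (Ω n)).withDensity
      fun ω => (terminalDensity i (Z n ω) : ℝ≥0∞) := fun n =>
    eq_withDensity_terminalDensity fun i => by
      have h := (E n).likelihood e i
      rw [(E n).filtration_end] at h
      exact h
  have hνd : ∀ i, (ν i : Measure (PathSpace I d)) =
      (ν (Fin.last d) : Measure (PathSpace I d)).withDensity
        fun x => (terminalDensity i (p x) : ℝ≥0∞) :=
    eq_withDensity_terminalDensity fun i => by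
      simpa only [e, hI.cylinderEvents_Iic_end] using hν.standard e i
  -- The marginal over the singleton `{e}` is the law of the time-`T` coordinate, up to this
  -- evaluation map.
  let q : (({e} : Finset I) → Fin d → ℝ≥0) → Fin d → ℝ≥0 := fun x => x ⟨e, by simp⟩
  have hq : Continuous q := continuous_apply _
  have hqmap : ∀ ρ : ProbabilityMeasure (PathSpace I d),
      (finiteMarginal ρ {e}).map hq.measurable.aemeasurable = ρ.map hp.aemeasurable := by
    intro ρ
    apply Subtype.ext
    change Measure.map _ (Measure.map _ _) = Measure.map _ _
    rw [Measure.map_map hq.measurable (Finset.measurable_restrict _)]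
    rfl
  have hpmap : ∀ n, ((E n).pathLaw (Fin.last d)).map hp.aemeasurable =
      ((E n).Q (Fin.last d)).map (hZ n).aemeasurable := by
    intro n
    apply Subtype.ext
    change Measure.map _ (Measure.map _ _) = Measure.map _ _
    rw [Measure.map_map hp (E n).measurable_Y]
    rfl
  have hsub := ProbabilityMeasure.tendsto_map_of_tendsto_of_continuous _ _
    (hν.tendsto_marginal (Fin.last d) {e}) hq
  simp only [hqmap, hpmap] at hsub
  obtain ⟨k₀, hk₀, hlim⟩ := exists_strictMono_tendsto_of_tendsto_comp hν.subnet
    (x := fun n => ((E n).Q (Fin.last d)).map (hZ n).aemeasurable) hsub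
  obtain ⟨h, hh, k, hk, htend⟩ := exists_test_tendsto_lintegral
    (D := terminalDensity (d := d)) continuous_terminalDensity
    (fun n => (E (k₀ n)).Q (Fin.last d)) (fun n => hZ (k₀ n)) hlim
    (fun i n => lintegral_terminalDensity (hE (k₀ n) i))
    (fun i => by
      change ∫⁻ z, _ ∂(Measure.map p _) = 1
      rw [lintegral_map ((continuous_terminalDensity i).measurable.coe_nnreal_ennreal) hp]
      exact lintegral_terminalDensity (hνd i))
    (fun n => hφ (k₀ n))
  have hψ : IsTest (h ∘ p) := ⟨hh.1.comp hp, fun x => hh.2 (p x)⟩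
  refine ⟨h ∘ p, hψ, k₀ ∘ k, hk₀.comp hk, fun i => ?_⟩
  have hDm : Measurable (terminalDensity i) := (continuous_terminalDensity i).measurable
  have hhm : Measurable h := hh.1
  have hval : ∫⁻ z, ENNReal.ofReal (h z) * terminalDensity i z
      ∂((ν (Fin.last d)).map hp.aemeasurable : Measure (Fin d → ℝ≥0)) =
      ∫⁻ x, ENNReal.ofReal ((h ∘ p) x) * terminalDensity i (p x)
        ∂(ν (Fin.last d) : Measure (PathSpace I d)) := by
    change ∫⁻ z, _ ∂(Measure.map p _) = _
    rw [lintegral_map (by fun_prop) hp]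
    rfl
  -- Finiteness is needed because `ENNReal.toReal` is discontinuous at `∞`.
  have hfin : ∫⁻ x, ENNReal.ofReal ((h ∘ p) x) * terminalDensity i (p x)
      ∂(ν (Fin.last d) : Measure (PathSpace I d)) ≠ ∞ := by
    refine ne_top_of_le_ne_top ENNReal.one_ne_top ?_
    rw [← lintegral_terminalDensity (hνd i)]
    exact lintegral_mono fun x => mul_le_of_le_one_left' (ENNReal.ofReal_le_one.2 (hψ.2 x).2)
  rw [integral_eq_toReal_lintegral_terminalDensity hp (hνd i) hψ]
  simp only [fun n => integral_eq_toReal_lintegral_terminalDensity (hZ n) (hE n i) (hφ n)]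
  have := htend i
  rw [hval] at this
  exact (ENNReal.tendsto_toReal hfin).comp this
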